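/- Let $0<\alpha\le 1$, let $\mu:\binom{[n]}{k}\to\mathbb R_{\ge 0}$ be not identically zero, and identify $\mu$ with the probability distribution proportional to it. Let $g_\mu(z)=\sum_S\mu(S)\prod_{i\in S}z_i$, and suppose that $\mu$ is $\alpha$-fractionally log-concave, i.e. that $\log g_\mu(z_1^\alpha,\dots,z_n^\alpha)$ is concave on $\mathbb R^n_{\ge 0}$ (with $\log 0=-\infty$). Let $\ell\ge 0$ be an integer with $\ell\le k-\lceil 1/\alpha\rceil$. Let $D_{k\to\ell}$ be the operator that moves from a $k$-set $S$ to a uniformly random $\ell$-subset $T\subseteq S$, let $U_{\ell\to k}$ be the operator that moves from $T$ to a $k$-set $S\supseteq T$ with probability proportional to $\mu(S)$, and let the $k\leftrightarrow\ell$ down-up walk be the Markov chain $P=D_{k\to\ell}U_{\ell\to k}$ on $k$-sets. Put $$\kappa=\frac{(k+1-\ell-1/\alpha)^{1/\alpha-\lceil 1/\alpha\rceil}\,\prod_{i=0}^{\lceil 1/\alpha\rceil-1}(k-\ell-i)}{(k+1)^{1/\alpha}} .$$ Then for every probability distribution $\nu$ on $\binom{[n]}{k}$, $$\mathcal D_{\mathrm{KL}}(\nu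 D_{k\to\ell}\,\|\,\mu D_{k\to\ell})\le(1-\kappa)\,\mathcal D_{\mathrm{KL}}(\nu\,\|\,\mu),$$ and the modified log-Sobolev constant of the down-up walk, $$\rho_0(P)=\inf\Big\{\frac{\mathcal E_P(f,\log f)}{2\,\mathrm{Ent}_\mu[f]}\;:\;f:\tbinom{[n]}{k}\to\mathbb R_{\ge 0},\ \mathrm{Ent}_\mu[f]\ne 0\Big\},$$ where $\mathcal E_P(f,g)=\langle (I-P)f,g\rangle_\mu$ and $\mathrm{Ent}_\mu[f]=\mathbb E_\mu[f\log f]-\mathbb E_\mu[f]\log\mathbb E_\mu[f]$, satisfies $\rho_0(P)\ge c\,\kappa$, where $c>0$ is an absolute constant. If $1/\alpha$ is an integer, then both assertions also hold with $$\kappa=\binom{k-\ell}{1/\alpha}\Big/\binom{k}{1/\alpha}.$$ -/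

import Mathlib

open scoped NNReal ENNReal Matrix

/-- The size-`k` subsets of the `n`-element ground set `[n]`. -/
abbrev KSubset (n k : ℕ) : Type := {S : Finset (Fin n) // S.card = k}

noncomputable section

namespace FLC

section MarkovChains

variable {Ω : Type*} [Fintype Ω]

/-- The probability distribution associated with a nonnegative, not identically zero weight
function: `μ` divided by its total mass. -/
def normalize (μ : Ω → ℝ) : Ω → ℝ := fun x => μ x / ∑ y, μ y

open Classical in
/-- Relative entropy `D(ν ‖ μ) = ∑ x, ν(x) log (ν(x) / μ(x))` of distributions on a finite set
(with `0 log 0 = 0`), equal to `∞` when `ν` is not absolutely continuous with respect to `μ`. -/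
def relEntropy (ν μ : Ω → ℝ) : EReal :=
  if ∀ x, μ x = 0 → ν x = 0 then ((∑ x, ν x * Real.log (ν x / μ x) : ℝ) : EReal) else ⊤

/-- `Ent_μ[f] = E_μ[f log f] - E_μ[f] log E_μ[f]`, with `0 log 0 = 0`. -/
def ent (μ : Ω → ℝ) (f : Ω → ℝ≥0) : ℝ :=
  (∑ x, μ x * ((f x : ℝ) * Real.log (f x))) -
    (∑ x, μ x * (f x : ℝ)) * Real.log (∑ x, μ x * (f x : ℝ))

/-- The Dirichlet form `⟨(I - P) f, g⟩_μ`. The second argument is allowed to take the values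
`±∞`, so that it can be evaluated at `g = log f` with `log 0 = -∞`; products follow the convention
`0 * (±∞) = 0`. -/
def dirichletForm (μ : Ω → ℝ) (P : Matrix Ω Ω ℝ) (f : Ω → ℝ) (g : Ω → EReal) : EReal :=
  ∑ x, ((μ x * (f x - (P *ᵥ f) x) : ℝ) : EReal) * g x

/-- The modified log-Sobolev constant `ρ₀(P)` of a chain `P` reversible with respect to the
probability distribution `μ`: the infimum of `𝓔_P(f, log f) / (2 Ent_μ[f])` over all `f ≥ 0` with
`Ent_μ[f] ≠ 0`. Here `ENNReal.log 0 = -∞`. For `f ≥ 0` and `P ≥ 0` no summand of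
`𝓔_P(f, log f)` is `-∞`, and the infimum over the empty set is `+∞`. States of `μ`-mass zero play
no role in this quantity when `P` is reversible with respect to `μ`. -/
def modifiedLogSobolev (μ : Ω → ℝ) (P : Matrix Ω Ω ℝ) : EReal :=
  sInf {r : EReal | ∃ f : Ω → ℝ≥0, ent μ f ≠ 0 ∧
    r = dirichletForm μ P (fun x => (f x : ℝ)) (fun x => ENNReal.log (f x : ℝ≥0∞)) /
      ((2 * ent μ f : ℝ) : EReal)}

end MarkovChains

/-- The down operator `D_{k → ℓ}`: from `S`, move to a uniformly random `ℓ`-subset of `S`. -/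
def down (n k ℓ : ℕ) : Matrix (KSubset n k) (KSubset n ℓ) ℝ :=
  Matrix.of fun S T => if T.1 ⊆ S.1 then 1 / (k.choose ℓ : ℝ) else 0

/-- The up operator `U_{ℓ → k}` with respect to the weight `μ` on `k`-subsets: from `T`, move to a
`k`-subset `S ⊇ T` with probability proportional to `μ S`. -/
def up {n k : ℕ} (ℓ : ℕ) (μ : KSubset n k → ℝ) : Matrix (KSubset n ℓ) (KSubset n k) ℝ :=
  Matrix.of fun T S =>
    if T.1 ⊆ S.1 then μ S / ∑ S' : KSubset n k, (if T.1 ⊆ S'.1 then μ S' else 0) else 0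

/-- The `k ↔ ℓ` down-up walk on `k`-subsets: first a down step, then an up step. -/
def downUp {n k : ℕ} (ℓ : ℕ) (μ : KSubset n k → ℝ) : Matrix (KSubset n k) (KSubset n k) ℝ :=
  down n k ℓ * up ℓ μ

/-- The generating polynomial `g_μ = ∑ S, μ(S) ∏_{i ∈ S} z_i`. -/
def genPoly {n k : ℕ} (μ : KSubset n k → ℝ) : MvPolynomial (Fin n) ℝ :=
  ∑ S : KSubset n k, MvPolynomial.C (μ S) * ∏ i ∈ S.1, MvPolynomial.X i

/-- The function `z ↦ g_μ(z_1 ^ α, …, z_n ^ α)`. -/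
def fracGen {n k : ℕ} (α : ℝ) (μ : KSubset n k → ℝ) (z : Fin n → ℝ) : ℝ :=
  MvPolynomial.eval (fun i => z i ^ α) (genPoly μ)

/-- `α`-fractional log-concavity: `log g_μ(z_1 ^ α, …, z_n ^ α)` is concave on the nonnegative
orthant, where `log 0 = -∞`. The concavity inequality
`s log F(x) + t log F(y) ≤ log F(s x + t y)` is written in exponentiated form, which is meaningful
also where `F` vanishes. -/
def IsFracLogConcave {n k : ℕ} (α : ℝ) (μ : KSubset n k → ℝ) : Prop :=
  ∀ x y : Fin n → ℝ, (∀ i, 0 ≤ x i) → (∀ i, 0 ≤ y i) →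
    ∀ s t : ℝ, 0 ≤ s → 0 ≤ t → s + t = 1 →
      fracGen α μ x ^ s * fracGen α μ y ^ t ≤ fracGen α μ (s • x + t • y)

/-- The contraction constant
`κ = (k + 1 - ℓ - 1/α) ^ (1/α - ⌈1/α⌉) * ∏_{i < ⌈1/α⌉} (k - ℓ - i) / (k + 1) ^ (1/α)`. -/
def kappa (k ℓ : ℕ) (α : ℝ) : ℝ :=
  ((k : ℝ) + 1 - ℓ - 1 / α) ^ (1 / α - (⌈1 / α⌉₊ : ℝ)) *
    (∏ i ∈ Finset.range ⌈1 / α⌉₊, ((k : ℝ) - ℓ - i)) / ((k : ℝ) + 1) ^ (1 / α)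

/-- `D_{k → ℓ}` contracts relative entropy with respect to (the normalization of) `μ` by the
factor `1 - κ`. -/
def DownContracts {n k : ℕ} (ℓ : ℕ) (μ : KSubset n k → ℝ) (κ : ℝ) : Prop :=
  ∀ ν ∈ stdSimplex ℝ (KSubset n k),
    relEntropy (ν ᵥ* down n k ℓ) (normalize μ ᵥ* down n k ℓ) ≤
      ((1 - κ : ℝ) : EReal) * relEntropy ν (normalize μ)

end FLC

end

namespace FLC

open Finset Filter Topology

/-! Write `H j` for `levelEntropy ν μ j`, the relative entropy of the images of `ν` and `μ` on
`j`-sets. Everything follows from one comparison of `H k - H ℓ` with `H k - H 0`.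

Log-concavity passes to the link of every `T`, by sending the variables in `T` to infinity. The
tangent hyperplane at the all-ones point then bounds the link's generating function. Evaluating it
at the ratios of the one-element marginals of `ν` and `μ`, and applying the log-sum inequality,
gives entropic independence of the link: its one-element marginals carry at most a fraction `1 / (α
(k - |T|))` of its relative entropy. Summing over `|T| = j`, the chain rule turns this into `H (j+1)
- H j ≤ (1/α) / (k - j) * (H k - H j)`. Iterating gives `H k - H ℓ ≥ localProd k ℓ α * (H k - H 0)`.

For probability distributions `H 0 = 0`, which is the contraction. For `ν = μ f` with `μ` a
probability distribution, `H k - H 0` is `ent μ f`, and Jensen's inequality above each `ℓ`-set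
bounds the Dirichlet form below by `H k - H ℓ`. Finally `localProd` is the binomial quotient when
`1/α` is an integer, and in general a quotient of Gamma values that log-convexity of Gamma bounds
below by `kappa`. -/

/-- The total `w`-weight of the `k`-subsets containing `T`. -/
def upSum {n k : ℕ} (w : KSubset n k → ℝ) (T : Finset (Fin n)) : ℝ :=
  ∑ S : KSubset n k, if T ⊆ S.1 then w S else 0

/-- The relative entropy of the images of the weights `ν` and `μ` on the `j`-subsets. -/
noncomputable def levelEntropy {n k : ℕ} (ν μ : KSubset n k → ℝ) (j : ℕ) : ℝ :=
  ∑ T ∈ powersetCard j (univ : Finset (Fin n)),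
    upSum ν T / (k.choose j : ℝ) * Real.log (upSum ν T / upSum μ T)

/-- The generating function of the link of `T`, evaluated at `z ^ α`. -/
noncomputable def linkGen {n k : ℕ} (α : ℝ) (μ : KSubset n k → ℝ) (T : Finset (Fin n)) (z : Fin n → ℝ) : ℝ :=
  ∑ S : KSubset n k, if T ⊆ S.1 then μ S * ∏ i ∈ S.1 \ T, z i ^ α else 0

/-! ### Double counting over subsets -/

section Sums

variable {n k : ℕ}

theorem upSum_nonneg {w : KSubset n k → ℝ} (hw : ∀ S, 0 ≤ w S) (T : Finset (Fin n)) :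
    0 ≤ upSum w T :=
  sum_nonneg fun S _ => by split_ifs <;> simp [hw]

theorem upSum_eq_zero_iff {w : KSubset n k → ℝ} (hw : ∀ S, 0 ≤ w S) (T : Finset (Fin n)) :
    upSum w T = 0 ↔ ∀ S : KSubset n k, T ⊆ S.1 → w S = 0 := by
  rw [upSum, sum_eq_zero_iff_of_nonneg (fun S _ => by split_ifs <;> simp [hw])]
  simp

theorem upSum_eq_zero_of_dominated {ν μ : KSubset n k → ℝ} (hν : ∀ S, 0 ≤ ν S)
    (hμ : ∀ S, 0 ≤ μ S) (h : ∀ S, μ S = 0 → ν S = 0) {T : Finset (Fin n)}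
    (hT : upSum μ T = 0) : upSum ν T = 0 :=
  (upSum_eq_zero_iff hν T).2 fun S hS => h S ((upSum_eq_zero_iff hμ T).1 hT S hS)

theorem upSum_insert_eq_zero {w : KSubset n k → ℝ} (hw : ∀ S, 0 ≤ w S) {T : Finset (Fin n)}
    (hT : upSum w T = 0) (i : Fin n) : upSum w (insert i T) = 0 :=
  (upSum_eq_zero_iff hw _).2 fun S hS =>
    (upSum_eq_zero_iff hw T).1 hT S ((subset_insert i T).trans hS)

theorem upSum_empty (w : KSubset n k → ℝ) : upSum w ∅ = ∑ S, w S := by simp [upSum]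

theorem upSum_coe (w : KSubset n k → ℝ) (S : KSubset n k) : upSum w S.1 = w S := by
  rw [upSum, sum_eq_single S]
  · simp
  · intro S' _ hne
    rw [if_neg]
    intro hsub
    exact hne (Subtype.ext (eq_of_subset_of_card_le hsub (by rw [S.2, S'.2])).symm)
  · simp

/-- Double counting of the pairs of a superset `S` of `T` and an element of `S \ T`. -/
theorem sum_upSum_insert_mul (w : KSubset n k → ℝ) (T : Finset (Fin n)) (c : Fin n → ℝ) :
    ∑ i ∈ Tᶜ, upSum w (insert i T) * c i =
      ∑ S : KSubset n k, if T ⊆ S.1 then w S * ∑ i ∈ S.1 \ T, c i else 0 := by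
  simp only [upSum, sum_mul]
  rw [sum_comm]
  refine sum_congr rfl fun S _ => ?_
  split_ifs with h
  · rw [mul_sum, ← sum_filter_add_sum_filter_not Tᶜ (· ∈ S.1)]
    rw [sum_eq_zero (s := filter (fun i => ¬ i ∈ S.1) Tᶜ), add_zero]
    · have : filter (· ∈ S.1) Tᶜ = S.1 \ T := by ext i; simp [and_comm]
      rw [this]
      refine sum_congr rfl fun i hi => ?_
      rw [if_pos (insert_subset (mem_sdiff.1 hi).1 h)]
    · intro i hi
      rw [if_neg, zero_mul]
      exact fun hs => (mem_filter.1 hi).2 (hs (mem_insert_self i T))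
  · refine sum_eq_zero fun i _ => ?_
    rw [if_neg, zero_mul]
    exact fun hs => h ((subset_insert i T).trans hs)

theorem sum_upSum_insert (w : KSubset n k → ℝ) (T : Finset (Fin n)) :
    ∑ i ∈ Tᶜ, upSum w (insert i T) = ((k : ℝ) - #T) * upSum w T := by
  have h := sum_upSum_insert_mul w T (fun _ => 1)
  simp only [mul_one] at h
  rw [h, upSum, mul_sum]
  refine sum_congr rfl fun S _ => ?_
  split_ifs with hs
  · rw [sum_const, card_sdiff_of_subset hs, S.2, nsmul_eq_mul, mul_one,
      Nat.cast_sub (S.2 ▸ card_le_card hs), mul_comm]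
  · simp

theorem sum_powersetCard_upSum (g : KSubset n k → ℝ) (j : ℕ) :
    ∑ T ∈ powersetCard j (univ : Finset (Fin n)), upSum g T = (k.choose j : ℝ) * ∑ S, g S := by
  simp only [upSum]
  rw [sum_comm, mul_sum]
  refine sum_congr rfl fun S _ => ?_
  rw [← sum_filter, sum_const, nsmul_eq_mul]
  congr 2
  have : filter (fun T => T ⊆ S.1) (powersetCard j univ) = powersetCard j S.1 := by
    ext T; simp [mem_powersetCard, and_comm]
  rw [this, card_powersetCard, S.2]

/-- A `(j+1)`-set arises as `insert i T` once for each choice of its element `i`. -/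
theorem sum_powersetCard_insert (f : Finset (Fin n) → ℝ) (j : ℕ) :
    ∑ T ∈ powersetCard j (univ : Finset (Fin n)), ∑ i ∈ Tᶜ, f (insert i T) =
      ((j : ℝ) + 1) * ∑ T ∈ powersetCard (j + 1) (univ : Finset (Fin n)), f T := by
  have h : ∑ T ∈ powersetCard (j + 1) (univ : Finset (Fin n)), ∑ i ∈ T, f T =
      ((j : ℝ) + 1) * ∑ T ∈ powersetCard (j + 1) (univ : Finset (Fin n)), f T := by
    rw [mul_sum]
    refine sum_congr rfl fun T hT => ?_
    rw [sum_const, (mem_powersetCard.1 hT).2, nsmul_eq_mul]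
    push_cast; rfl
  rw [← h, sum_sigma', sum_sigma']
  refine sum_bij' (fun p _ => ⟨insert p.2 p.1, p.2⟩) (fun p _ => ⟨p.1.erase p.2, p.2⟩)
    ?_ ?_ ?_ ?_ ?_
  · rintro ⟨T, i⟩ hp
    simp only [mem_sigma, mem_powersetCard, subset_univ, true_and, mem_compl] at hp ⊢
    simp [card_insert_of_notMem hp.2, hp.1]
  · rintro ⟨T, i⟩ hp
    simp only [mem_sigma, mem_powersetCard, subset_univ, true_and, mem_compl] at hp ⊢
    simp [card_erase_of_mem hp.2, hp.1]
  · rintro ⟨T, i⟩ hp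
    simp only [mem_sigma, mem_compl] at hp
    simp [erase_insert hp.2]
  · rintro ⟨T, i⟩ hp
    simp only [mem_sigma] at hp
    simp [insert_erase hp.2]
  · rintro ⟨T, i⟩ _; rfl

theorem levelEntropy_self (ν μ : KSubset n k → ℝ) :
    levelEntropy ν μ k = ∑ S, ν S * Real.log (ν S / μ S) := by
  rw [levelEntropy, ← sum_subtype (powersetCard k (univ : Finset (Fin n)))
    (p := fun S => S.card = k) (by simp [mem_powersetCard])
    (fun T => upSum ν T / (k.choose k : ℝ) * Real.log (upSum ν T / upSum μ T)) |>.symm]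
  refine sum_congr rfl fun S _ => ?_
  simp [upSum_coe]

theorem levelEntropy_zero (ν μ : KSubset n k → ℝ) :
    levelEntropy ν μ 0 = (∑ S, ν S) * Real.log ((∑ S, ν S) / ∑ S, μ S) := by
  simp [levelEntropy, upSum_empty]

end Sums

/-- The log-sum inequality. -/
theorem log_sum_le {ι : Type*} (s : Finset ι) {a b : ι → ℝ} (ha : ∀ i ∈ s, 0 ≤ a i)
    (hb : ∀ i ∈ s, 0 ≤ b i) (hab : ∀ i ∈ s, b i = 0 → a i = 0) :
    (∑ i ∈ s, a i) * Real.log ((∑ i ∈ s, a i) / ∑ i ∈ s, b i) ≤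
      ∑ i ∈ s, a i * Real.log (a i / b i) := by
  set A := ∑ i ∈ s, a i with hA
  set B := ∑ i ∈ s, b i with hB
  rcases (sum_nonneg ha).eq_or_lt with h0 | hApos
  · have h0' := (sum_eq_zero_iff_of_nonneg ha).1 h0.symm
    rw [hA, ← h0, zero_mul, sum_eq_zero]
    intro i hi; rw [h0' i hi, zero_mul]
  have hBpos : 0 < B := by
    refine (sum_nonneg hb).lt_of_ne fun h => hApos.ne ?_
    rw [sum_eq_zero]
    exact fun i hi => hab i hi ((sum_eq_zero_iff_of_nonneg hb).1 h.symm i hi)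
  -- Termwise form of `log x ≤ x - 1`; the corrections `a i - b i * (A / B)` sum to zero.
  have key : ∀ i ∈ s, a i * Real.log (A / B) + (a i - b i * (A / B)) ≤
      a i * Real.log (a i / b i) := by
    intro i hi
    have hAB : 0 < A / B := div_pos hApos hBpos
    rcases (ha i hi).eq_or_lt with h | h
    · rw [← h]; simp only [zero_mul, zero_sub, zero_add]
      nlinarith [mul_nonneg (hb i hi) hAB.le]
    · have hbi : 0 < b i := (hb i hi).lt_of_ne fun h' => h.ne' (hab i hi h'.symm)
      have h1 := Real.log_le_sub_one_of_pos (x := (A / B) / (a i / b i)) (by positivity)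
      rw [Real.log_div hAB.ne' (by positivity)] at h1
      have h2 := mul_le_mul_of_nonneg_left h1 h.le
      have h3 : a i * ((A / B) / (a i / b i) - 1) = b i * (A / B) - a i := by
        field_simp
      linarith
  have := sum_le_sum key
  rw [sum_add_distrib, sum_sub_distrib, ← sum_mul, ← sum_mul, ← hA, ← hB,
    mul_div_cancel₀ A hBpos.ne'] at this
  linarith

/-! ### Generating functions of links -/

section Links

variable {n k : ℕ} {α : ℝ} {μ : KSubset n k → ℝ}

theorem fracGen_eq (α : ℝ) (μ : KSubset n k → ℝ) (z : Fin n → ℝ) :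
    fracGen α μ z = ∑ S, μ S * ∏ i ∈ S.1, z i ^ α := by
  simp [fracGen, genPoly, map_sum, map_prod]

theorem linkGen_one (α : ℝ) (μ : KSubset n k → ℝ) (T : Finset (Fin n)) :
    linkGen α μ T (fun _ => 1) = upSum μ T := by simp [linkGen, upSum]

theorem linkGen_nonneg (hμ : ∀ S, 0 ≤ μ S) (T : Finset (Fin n)) {z : Fin n → ℝ}
    (hz : ∀ i, 0 ≤ z i) : 0 ≤ linkGen α μ T z :=
  sum_nonneg fun S _ => by
    split_ifs
    · exact mul_nonneg (hμ S) (prod_nonneg fun i _ => Real.rpow_nonneg (hz i) α)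
    · exact le_rfl

theorem fracGen_nonneg (hμ : ∀ S, 0 ≤ μ S) {z : Fin n → ℝ}
    (hz : ∀ i, 0 ≤ z i) : 0 ≤ fracGen α μ z := by
  rw [fracGen_eq]
  exact sum_nonneg fun S _ =>
    mul_nonneg (hμ S) (prod_nonneg fun i _ => Real.rpow_nonneg (hz i) α)

/-- The generating function of a link is a limit of rescalings of the generating function. -/
theorem tendsto_fracGen_linkGen (hα : 0 < α) (T : Finset (Fin n)) (z : Fin n → ℝ) :
    Tendsto (fun c : ℝ => c ^ (-(α * #T)) * fracGen α μ (fun i => if i ∈ T then c else z i))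
      atTop (𝓝 (linkGen α μ T z)) := by
  simp only [fracGen_eq, linkGen, mul_sum]
  refine tendsto_finsetSum _ fun S _ => ?_
  -- The term of `S` scales as `c` to the power `-α (|T| - |S ∩ T|)`, so only the sets containing
  -- `T` survive in the limit.
  have hev : (fun c : ℝ => c ^ (-(α * ((#T : ℝ) - #(S.1 ∩ T)))) *
        (μ S * ∏ i ∈ S.1 \ T, z i ^ α)) =ᶠ[atTop]
      fun c : ℝ => c ^ (-(α * #T)) * (μ S * ∏ i ∈ S.1, (if i ∈ T then c else z i) ^ α) := by
    filter_upwards [eventually_gt_atTop 0] with c hc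
    rw [← prod_inter_mul_prod_sdiff S.1 T (fun i => (if i ∈ T then c else z i) ^ α)]
    have h1 : ∏ i ∈ S.1 ∩ T, (if i ∈ T then c else z i) ^ α = c ^ (α * #(S.1 ∩ T)) := by
      rw [prod_congr rfl (g := fun _ => c ^ α), prod_const, ← Real.rpow_natCast, ← Real.rpow_mul hc.le]
      intro i hi; rw [if_pos (mem_inter.1 hi).2]
    have h2 : ∏ i ∈ S.1 \ T, (if i ∈ T then c else z i) ^ α = ∏ i ∈ S.1 \ T, z i ^ α :=
      prod_congr rfl fun i hi => by rw [if_neg (mem_sdiff.1 hi).2]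
    rw [h1, h2, show -(α * ((#T : ℝ) - #(S.1 ∩ T))) = -(α * #T) + α * #(S.1 ∩ T) by ring,
      Real.rpow_add hc]
    ring
  refine Tendsto.congr' hev ?_
  split_ifs with h
  · rw [inter_eq_right.2 h]; simp
  · have hlt : #(S.1 ∩ T) < #T :=
      card_lt_card (inter_subset_right.ssubset_of_ne fun he => h (inter_eq_right.1 he))
    have hpos : 0 < α * ((#T : ℝ) - #(S.1 ∩ T)) :=
      mul_pos hα (sub_pos.2 (by exact_mod_cast hlt))
    simpa using (tendsto_rpow_neg_atTop hpos).mul_const (μ S * ∏ i ∈ S.1 \ T, z i ^ α)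

/-- Links of a fractionally log-concave weight are fractionally log-concave. -/
theorem IsFracLogConcave.linkGen_le (h : IsFracLogConcave α μ) (hα : 0 < α)
    (hμ : ∀ S, 0 ≤ μ S) (T : Finset (Fin n)) {x y : Fin n → ℝ} (hx : ∀ i, 0 ≤ x i)
    (hy : ∀ i, 0 ≤ y i) {s t : ℝ} (hs : 0 ≤ s) (ht : 0 ≤ t) (hst : s + t = 1) :
    linkGen α μ T x ^ s * linkGen α μ T y ^ t ≤ linkGen α μ T (s • x + t • y) := by
  have hX := (tendsto_fracGen_linkGen (μ := μ) hα T x).rpow_const (p := s) (Or.inr hs)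
  have hY := (tendsto_fracGen_linkGen (μ := μ) hα T y).rpow_const (p := t) (Or.inr ht)
  refine le_of_tendsto_of_tendsto (hX.mul hY)
    (tendsto_fracGen_linkGen hα T (s • x + t • y)) ?_
  filter_upwards [eventually_gt_atTop 0] with c hc
  have hx' : ∀ i, 0 ≤ (fun i => if i ∈ T then c else x i) i := fun i => by
    dsimp only; split_ifs; exacts [hc.le, hx i]
  have hy' : ∀ i, 0 ≤ (fun i => if i ∈ T then c else y i) i := fun i => by
    dsimp only; split_ifs; exacts [hc.le, hy i]
  have key := h _ _ hx' hy' s t hs ht hst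
  have he : (s • (fun i => if i ∈ T then c else x i) + t • fun i => if i ∈ T then c else y i) =
      fun i => if i ∈ T then c else (s • x + t • y) i := by
    funext i
    simp only [Pi.add_apply, Pi.smul_apply, smul_eq_mul]
    split_ifs
    · rw [← add_mul, hst, one_mul]
    · rfl
  rw [he] at key
  have hC : 0 < c ^ (-(α * #T)) := Real.rpow_pos_of_pos hc _
  rw [Real.mul_rpow hC.le (fracGen_nonneg hμ hx'), Real.mul_rpow hC.le (fracGen_nonneg hμ hy')]
  calc _ = (c ^ (-(α * #T))) ^ (s + t) * (fracGen α μ (fun i => if i ∈ T then c else x i) ^ s *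
        fracGen α μ (fun i => if i ∈ T then c else y i) ^ t) := by
          rw [Real.rpow_add hC]; ring
    _ ≤ _ := by
      rw [hst, Real.rpow_one]
      exact mul_le_mul_of_nonneg_left key hC.le

theorem hasDerivAt_linkGen_segment (T : Finset (Fin n)) (z : Fin n → ℝ) :
    HasDerivAt (fun t : ℝ => linkGen α μ T (fun i => 1 + t * (z i - 1)))
      (α * ∑ i ∈ Tᶜ, upSum μ (insert i T) * (z i - 1)) 0 := by
  rw [sum_upSum_insert_mul, mul_sum]
  simp only [linkGen]
  refine HasDerivAt.fun_sum fun S _ => ?_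
  split_ifs with h
  · have h1 : ∀ i ∈ S.1 \ T,
        HasDerivAt (fun t : ℝ => (1 + t * (z i - 1)) ^ α) (α * (z i - 1)) 0 := by
      intro i _
      have h2 : HasDerivAt (fun t : ℝ => 1 + t * (z i - 1)) (1 * (z i - 1)) 0 :=
        ((hasDerivAt_id' (0 : ℝ)).mul_const (z i - 1)).const_add 1
      refine (h2.rpow_const (p := α) (by simp)).congr_deriv ?_
      simp [mul_comm]
    refine ((HasDerivAt.fun_finsetProd h1).const_mul (μ S)).congr_deriv ?_
    simp only [zero_mul, add_zero, Real.one_rpow, prod_const_one, smul_eq_mul, one_mul]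
    rw [← mul_sum]; ring
  · simpa using hasDerivAt_const (0 : ℝ) (0 : ℝ)

/-- The tangent hyperplane at `1` bounds the generating function of a link. -/
theorem IsFracLogConcave.linkGen_le_upSum (h : IsFracLogConcave α μ) (hα : 0 < α)
    (hμ : ∀ S, 0 ≤ μ S) {T : Finset (Fin n)} (hT : 0 < upSum μ T) {z : Fin n → ℝ}
    (hz : ∀ i, 0 ≤ z i) (hz1 : ∑ i ∈ Tᶜ, upSum μ (insert i T) * (z i - 1) = 0) :
    linkGen α μ T z ≤ upSum μ T := by
  rcases (linkGen_nonneg (α := α) hμ T hz).eq_or_lt with h0 | hpos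
  · rw [← h0]; exact hT.le
  set M := upSum μ T with hM
  set H := linkGen α μ T z with hH
  have hd1 := hasDerivAt_linkGen_segment (α := α) (μ := μ) T z
  rw [hz1, mul_zero] at hd1
  have hd2 : HasDerivAt (fun t : ℝ => M * (H / M) ^ t) (M * Real.log (H / M)) 0 := by
    refine (((hasDerivAt_id' (0 : ℝ)).const_rpow (a := H / M) (by positivity)).const_mul
      M).congr_deriv ?_
    simp
  -- Along the segment from the all-ones point to `z`, concavity puts the generating function above
  -- `M * (H / M) ^ t`. The two agree at `t = 0`, so their right derivatives there, `0` and `M * log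
  -- (H / M)`, are ordered.
  have hle : 0 ≤ 0 - M * Real.log (H / M) := by
    refine ge_of_tendsto (hd1.sub hd2).tendsto_slope_zero_right ?_
    filter_upwards [Ioo_mem_nhdsGT (zero_lt_one' ℝ)] with t ht
    refine smul_nonneg (inv_nonneg.2 ht.1.le) ?_
    have key := h.linkGen_le hα hμ T (x := fun _ => 1) (fun _ => zero_le_one) hz
      (sub_nonneg.2 ht.2.le) ht.1.le (sub_add_cancel 1 t)
    have he : ((1 - t) • (fun _ => (1 : ℝ)) + t • z : Fin n → ℝ) =
        fun i => 1 + t * (z i - 1) := by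
      funext i; simp only [Pi.add_apply, Pi.smul_apply, smul_eq_mul]; ring
    rw [he, linkGen_one, Real.rpow_sub hT, Real.rpow_one] at key
    have h0 : linkGen α μ T (fun i => 1 + 0 * (z i - 1)) - M * (H / M) ^ (0 : ℝ) = 0 := by
      simp [linkGen_one, hM]
    simp only [Pi.sub_apply, h0, sub_zero, zero_add]
    rw [sub_nonneg, Real.div_rpow hpos.le hT.le]
    refine le_trans (le_of_eq ?_) key
    ring
  by_contra! hlt
  have : 0 < Real.log (H / M) := Real.log_pos ((one_lt_div hT).2 hlt)
  nlinarith [mul_pos hT this]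

end Links

/-! ### Entropic independence and the local-to-global argument -/

section

variable {n k : ℕ} {α : ℝ} {μ ν : KSubset n k → ℝ}

/-- Entropic independence of the link of `T`. -/
theorem IsFracLogConcave.link_entropy_le (h : IsFracLogConcave α μ) (hα : 0 < α)
    (hμ : ∀ S, 0 ≤ μ S) (hν : ∀ S, 0 ≤ ν S) (hνμ : ∀ S, μ S = 0 → ν S = 0)
    (T : Finset (Fin n)) :
    α * ∑ i ∈ Tᶜ, upSum ν (insert i T) *
        (Real.log (upSum ν (insert i T) / upSum μ (insert i T)) -
          Real.log (upSum ν T / upSum μ T)) ≤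
      ∑ S : KSubset n k, if T ⊆ S.1 then
        ν S * (Real.log (ν S / μ S) - Real.log (upSum ν T / upSum μ T)) else 0 := by
  rcases (upSum_nonneg hν T).eq_or_lt with h0 | hN
  · rw [sum_eq_zero, sum_eq_zero, mul_zero]
    · intro S _
      split_ifs with hs
      · rw [(upSum_eq_zero_iff hν T).1 h0.symm S hs, zero_mul]
      · rfl
    · intro i _
      rw [upSum_insert_eq_zero hν h0.symm, zero_mul]
  have hM : 0 < upSum μ T := (upSum_nonneg hμ T).lt_of_ne fun h' =>
    hN.ne' (upSum_eq_zero_of_dominated hν hμ hνμ h'.symm)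
  set L := Real.log (upSum ν T / upSum μ T) with hL
  -- The density of the one-element marginal of `ν` against that of `μ` in the link, normalized so
  -- that the first-order term of the tangent bound vanishes.
  let z : Fin n → ℝ := fun i =>
    (upSum ν (insert i T) / upSum μ (insert i T)) / (upSum ν T / upSum μ T)
  have hz : ∀ i, 0 ≤ z i := fun i => by
    have := upSum_nonneg hν (insert i T)
    have := upSum_nonneg hμ (insert i T)
    positivity
  have hmz : ∀ i, upSum μ (insert i T) * z i =
      upSum ν (insert i T) * (upSum μ T / upSum ν T) := by
    intro i
    by_cases hi : upSum μ (insert i T) = 0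
    · rw [hi, upSum_eq_zero_of_dominated hν hμ hνμ hi]; simp
    · simp only [z]; field_simp
  have hz1 : ∑ i ∈ Tᶜ, upSum μ (insert i T) * (z i - 1) = 0 := by
    simp only [mul_sub, hmz, mul_one, sum_sub_distrib, ← sum_mul, sum_upSum_insert]
    field_simp
    ring
  have hle := h.linkGen_le_upSum hα hμ hM hz hz1
  have hlogz : ∀ i, upSum ν (insert i T) *
      (Real.log (upSum ν (insert i T) / upSum μ (insert i T)) - L) =
      upSum ν (insert i T) * Real.log (z i) := by
    intro i
    by_cases hi : upSum ν (insert i T) = 0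
    · rw [hi, zero_mul, zero_mul]
    · have hi' : upSum μ (insert i T) ≠ 0 := fun h' =>
        hi (upSum_eq_zero_of_dominated hν hμ hνμ h')
      rw [hL, ← Real.log_div (by positivity) (by positivity)]
  rw [sum_congr rfl fun i _ => hlogz i, sum_upSum_insert_mul]
  have hzpos : ∀ S : KSubset n k, T ⊆ S.1 → ν S ≠ 0 → ∀ i ∈ S.1 \ T, 0 < z i := by
    intro S hS hνS i hi
    have h1 : 0 < upSum ν (insert i T) := (upSum_nonneg hν _).lt_of_ne fun h' =>
      hνS ((upSum_eq_zero_iff hν _).1 h'.symm S (insert_subset (mem_sdiff.1 hi).1 hS))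
    have h2 : 0 < upSum μ (insert i T) := (upSum_nonneg hμ _).lt_of_ne fun h' =>
      h1.ne' (upSum_eq_zero_of_dominated hν hμ hνμ h'.symm)
    simp only [z]; positivity
  -- Compare `ν` on the link with `μ` tilted by `∏ z i ^ α`. On the support of `ν` all the relevant
  -- `z i` are positive, so the logarithm of the product splits; the tilted mass is at most `upSum μ
  -- T`.
  have hls := log_sum_le (univ : Finset (KSubset n k))
    (a := fun S => if T ⊆ S.1 ∧ ν S ≠ 0 then ν S else 0)
    (b := fun S => if T ⊆ S.1 ∧ ν S ≠ 0 then μ S * ∏ i ∈ S.1 \ T, z i ^ α else 0)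
    (fun S _ => by split_ifs <;> simp [hν])
    (fun S _ => by
      split_ifs
      · exact mul_nonneg (hμ S) (prod_nonneg fun i _ => Real.rpow_nonneg (hz i) α)
      · rfl)
    (fun S _ => by
      split_ifs with hS
      · intro hb
        rcases mul_eq_zero.1 hb with h' | h'
        · exact hνμ S h'
        · exact absurd h' (prod_pos fun i hi =>
            Real.rpow_pos_of_pos (hzpos S hS.1 hS.2 i hi) α).ne'
      · simp)
  have hsa : ∑ S : KSubset n k, (if T ⊆ S.1 ∧ ν S ≠ 0 then ν S else 0) = upSum ν T := by
    refine sum_congr rfl fun S _ => ?_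
    by_cases h' : ν S = 0 <;> simp [h']
  have hsb : ∑ S : KSubset n k,
      (if T ⊆ S.1 ∧ ν S ≠ 0 then μ S * ∏ i ∈ S.1 \ T, z i ^ α else 0) ≤ upSum μ T := by
    refine le_trans (sum_le_sum fun S _ => ?_) hle
    have : 0 ≤ μ S * ∏ i ∈ S.1 \ T, z i ^ α :=
      mul_nonneg (hμ S) (prod_nonneg fun i _ => Real.rpow_nonneg (hz i) α)
    split_ifs <;> simp_all
  rw [hsa] at hls
  set B := ∑ S : KSubset n k,
      (if T ⊆ S.1 ∧ ν S ≠ 0 then μ S * ∏ i ∈ S.1 \ T, z i ^ α else 0) with hB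
  have hBpos : 0 < B := by
    obtain ⟨S, hS, hνS⟩ : ∃ S : KSubset n k, T ⊆ S.1 ∧ ν S ≠ 0 := by
      by_contra! hcon
      exact hN.ne' ((upSum_eq_zero_iff hν T).2 hcon)
    refine sum_pos' (fun S _ => ?_) ⟨S, mem_univ S, ?_⟩
    · split_ifs
      · exact mul_nonneg (hμ S) (prod_nonneg fun i _ => Real.rpow_nonneg (hz i) α)
      · rfl
    · rw [if_pos ⟨hS, hνS⟩]
      exact mul_pos ((hμ S).lt_of_ne fun h' => hνS (hνμ S h'.symm))
        (prod_pos fun i hi => Real.rpow_pos_of_pos (hzpos S hS hνS i hi) α)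
  have hmono : upSum ν T * L ≤ upSum ν T * Real.log (upSum ν T / B) := by
    refine mul_le_mul_of_nonneg_left (Real.log_le_log (by positivity) ?_) hN.le
    exact div_le_div_of_nonneg_left hN.le hBpos hsb
  have hfin : ∑ S : KSubset n k, (if T ⊆ S.1 ∧ ν S ≠ 0 then ν S else 0) *
        Real.log ((if T ⊆ S.1 ∧ ν S ≠ 0 then ν S else 0) /
          (if T ⊆ S.1 ∧ ν S ≠ 0 then μ S * ∏ i ∈ S.1 \ T, z i ^ α else 0)) =
      (∑ S : KSubset n k, if T ⊆ S.1 then ν S * (Real.log (ν S / μ S) - L) else 0) +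
        upSum ν T * L -
        α * ∑ S : KSubset n k, if T ⊆ S.1 then ν S * ∑ i ∈ S.1 \ T, Real.log (z i) else 0 := by
    rw [upSum, sum_mul, mul_sum, ← sum_add_distrib, ← sum_sub_distrib]
    refine sum_congr rfl fun S _ => ?_
    by_cases hS : T ⊆ S.1
    · by_cases hνS : ν S = 0
      · simp [hνS]
      · have hp := hzpos S hS hνS
        have hμS : μ S ≠ 0 := fun h' => hνS (hνμ S h')
        have hpr : ∏ i ∈ S.1 \ T, z i ^ α ≠ 0 :=
          (prod_pos fun i hi => Real.rpow_pos_of_pos (hp i hi) α).ne'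
        simp only [hS, hνS, ne_eq, not_false_eq_true, and_self, if_true]
        rw [Real.log_div hνS (mul_ne_zero hμS hpr), Real.log_mul hμS hpr,
          Real.log_div hνS hμS, Real.log_prod (fun i hi =>
            (Real.rpow_pos_of_pos (hp i hi) α).ne'),
          sum_congr rfl fun i hi => Real.log_rpow (hp i hi) α, ← mul_sum]
        ring
    · simp [hS]
  rw [hfin] at hls
  linarith

/-- One step of the local-to-global argument. -/
theorem IsFracLogConcave.levelEntropy_step (h : IsFracLogConcave α μ) (hα : 0 < α)
    (hμ : ∀ S, 0 ≤ μ S) (hν : ∀ S, 0 ≤ ν S) (hνμ : ∀ S, μ S = 0 → ν S = 0)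
    {j : ℕ} (hj : j < k) :
    (1 - 1 / α / ((k : ℝ) - j)) * (levelEntropy ν μ k - levelEntropy ν μ j) ≤
      levelEntropy ν μ k - levelEntropy ν μ (j + 1) := by
  let L : Finset (Fin n) → ℝ := fun T => Real.log (upSum ν T / upSum μ T)
  -- Chain rule: up to the factor `k.choose j`, the right sides add up to `H k - H j`, and the left
  -- sides to `α (k - j) (H (j+1) - H j)`.
  have hsum := sum_le_sum fun T (_ : T ∈ powersetCard j (univ : Finset (Fin n))) =>
    h.link_entropy_le hα hμ hν hνμ T
  have hkj : (0 : ℝ) < (k : ℝ) - j := sub_pos.2 (by exact_mod_cast hj)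
  have hC : (0 : ℝ) < k.choose j := by exact_mod_cast Nat.choose_pos hj.le
  have hC' : (0 : ℝ) < k.choose (j + 1) := by exact_mod_cast Nat.choose_pos hj
  have hCC : (k.choose (j + 1) : ℝ) * (j + 1) = k.choose j * ((k : ℝ) - j) := by
    rw [← Nat.cast_sub hj.le]; exact_mod_cast Nat.choose_succ_right_eq k j
  have hA : ∀ i, (0 : ℝ) < k.choose i → ∑ T ∈ powersetCard i (univ : Finset (Fin n)),
      upSum ν T * L T = k.choose i * levelEntropy ν μ i := by
    intro i hi
    rw [levelEntropy, mul_sum]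
    refine sum_congr rfl fun T _ => ?_
    simp only [L]; field_simp
  have hleft : ∑ T ∈ powersetCard j (univ : Finset (Fin n)), α * ∑ i ∈ Tᶜ,
      upSum ν (insert i T) * (L (insert i T) - L T) =
      α * (k.choose j * ((k : ℝ) - j) * (levelEntropy ν μ (j + 1) - levelEntropy ν μ j)) := by
    rw [← mul_sum]
    congr 1
    simp only [mul_sub, sum_sub_distrib]
    rw [sum_powersetCard_insert (fun T => upSum ν T * L T) j, hA _ hC']
    have : ∑ T ∈ powersetCard j (univ : Finset (Fin n)), ∑ i ∈ Tᶜ, upSum ν (insert i T) * L T =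
        ((k : ℝ) - j) * (k.choose j * levelEntropy ν μ j) := by
      rw [← hA j hC, mul_sum]
      refine sum_congr rfl fun T hT => ?_
      rw [← sum_mul, sum_upSum_insert, (mem_powersetCard.1 hT).2]
      ring
    rw [this]
    linear_combination levelEntropy ν μ (j + 1) * hCC
  have hright : ∑ T ∈ powersetCard j (univ : Finset (Fin n)), ∑ S : KSubset n k,
      (if T ⊆ S.1 then ν S * (Real.log (ν S / μ S) - L T) else 0) =
      k.choose j * (levelEntropy ν μ k - levelEntropy ν μ j) := by
    have : ∀ T : Finset (Fin n), ∑ S : KSubset n k,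
        (if T ⊆ S.1 then ν S * (Real.log (ν S / μ S) - L T) else 0) =
        upSum (fun S => ν S * Real.log (ν S / μ S)) T - upSum ν T * L T := by
      intro T
      rw [upSum, upSum, sum_mul, ← sum_sub_distrib]
      refine sum_congr rfl fun S _ => ?_
      split_ifs <;> ring
    simp only [this]
    rw [sum_sub_distrib, sum_powersetCard_upSum, hA j hC, levelEntropy_self]
    ring
  have hfinal : α * ((k : ℝ) - j) * (levelEntropy ν μ (j + 1) - levelEntropy ν μ j) ≤
      levelEntropy ν μ k - levelEntropy ν μ j := by
    refine le_of_mul_le_mul_left ?_ hC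
    have := hleft.symm.le.trans (hsum.trans hright.le)
    linarith
  have : levelEntropy ν μ (j + 1) - levelEntropy ν μ j ≤
      1 / α / ((k : ℝ) - j) * (levelEntropy ν μ k - levelEntropy ν μ j) := by
    rw [div_div, div_mul_eq_mul_div, one_mul, le_div_iff₀ (by positivity)]
    linarith
  linarith

theorem levelEntropy_zero_le (hμ : ∀ S, 0 ≤ μ S) (hν : ∀ S, 0 ≤ ν S)
    (hνμ : ∀ S, μ S = 0 → ν S = 0) : levelEntropy ν μ 0 ≤ levelEntropy ν μ k := by
  rw [levelEntropy_zero, levelEntropy_self]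
  exact log_sum_le univ (fun S _ => hν S) (fun S _ => hμ S) fun S _ => hνμ S

/-- The product of the local contraction factors. -/
noncomputable def localProd (k ℓ : ℕ) (α : ℝ) : ℝ :=
  ∏ j ∈ range ℓ, (1 - 1 / α / ((k : ℝ) - j))

theorem IsFracLogConcave.localProd_mul_le (h : IsFracLogConcave α μ) (hα : 0 < α)
    (hμ : ∀ S, 0 ≤ μ S) (hν : ∀ S, 0 ≤ ν S) (hνμ : ∀ S, μ S = 0 → ν S = 0)
    {ℓ : ℕ} (hℓ : ℓ + ⌈1 / α⌉₊ ≤ k) :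
    localProd k ℓ α * (levelEntropy ν μ k - levelEntropy ν μ 0) ≤
      levelEntropy ν μ k - levelEntropy ν μ ℓ := by
  have hm : 0 < ⌈1 / α⌉₊ := Nat.ceil_pos.2 (by positivity)
  have hr : 1 / α ≤ ⌈1 / α⌉₊ := Nat.le_ceil _
  induction ℓ with
  | zero => simp [localProd]
  | succ ℓ ih =>
    refine le_trans ?_ (h.levelEntropy_step hα hμ hν hνμ (by omega))
    rw [localProd, prod_range_succ, mul_comm _ (1 - 1 / α / ((k : ℝ) - ℓ)), mul_assoc]
    -- The gap `⌈1/α⌉₊` below `k` keeps the local factor nonnegative, so the bounds can be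
    -- multiplied.
    refine mul_le_mul_of_nonneg_left (ih (by omega)) ?_
    have : ((ℓ : ℝ) + 1) + ⌈1 / α⌉₊ ≤ k := by exact_mod_cast hℓ
    rw [sub_nonneg, div_le_one (by have : (0 : ℝ) < 1 / α := by positivity
                                   linarith)]
    linarith

end

/-! ### Estimates for the contraction constant -/

/-- By convexity of `log Γ`, its slope over `[x - s, x]` is at most its slope over `[x, x + 1]`,
which is `log x`. -/
theorem Gamma_le_Gamma_sub_mul_rpow {x s : ℝ} (hs : 0 ≤ s) (hsx : s < x) :
    Real.Gamma x ≤ Real.Gamma (x - s) * x ^ s := by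
  rcases hs.eq_or_lt with rfl | hs
  · simp
  have hx : 0 < x := hs.trans hsx
  have h := Real.convexOn_log_Gamma.slope_mono_adjacent (x := x - s) (y := x) (z := x + 1)
    (Set.mem_Ioi.2 (sub_pos.2 hsx)) (Set.mem_Ioi.2 (by linarith)) (by linarith) (by linarith)
  have hG := Real.Gamma_pos_of_pos hx
  have hG' := Real.Gamma_pos_of_pos (sub_pos.2 hsx)
  simp only [Function.comp_apply, sub_sub_cancel, add_sub_cancel_left, div_one,
    Real.Gamma_add_one hx.ne', Real.log_mul hx.ne' hG.ne', add_sub_cancel_right] at h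
  rw [div_le_iff₀ hs, ← Real.log_div hG.ne' hG'.ne', mul_comm, ← Real.log_rpow hx,
    Real.log_le_log_iff (by positivity) (by positivity), div_le_iff₀ hG'] at h
  linarith

theorem Gamma_eq_prod_mul_Gamma {N : ℝ} {m : ℕ} (h : (m : ℝ) < N + 1) :
    Real.Gamma (N + 1) = (∏ i ∈ range m, (N - i)) * Real.Gamma (N + 1 - m) := by
  induction m with
  | zero => simp
  | succ m ih =>
    push_cast at h
    rw [ih (by linarith), prod_range_succ, mul_assoc]
    congr 1
    rw [show N + 1 - (m : ℝ) = N - m + 1 by ring, Real.Gamma_add_one (by linarith)]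
    congr 2
    push_cast; ring

/-- Needed when `ν` is not absolutely continuous: `(1 - κ) * ⊤` is `⊤` only if `κ < 1`. -/
theorem localProd_lt_one {k ℓ : ℕ} {α : ℝ} (hα : 0 < α) (hℓ0 : 0 < ℓ)
    (hℓ : ℓ + ⌈1 / α⌉₊ ≤ k) : localProd k ℓ α < 1 := by
  have hr : 1 / α ≤ ⌈1 / α⌉₊ := Nat.le_ceil _
  have hr0 : 0 < 1 / α := by positivity
  have hk : (ℓ : ℝ) + ⌈1 / α⌉₊ ≤ k := by exact_mod_cast hℓ
  have hf : ∀ j ∈ range ℓ, 0 ≤ 1 - 1 / α / ((k : ℝ) - j) ∧ 1 - 1 / α / ((k : ℝ) - j) < 1 := by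
    intro j hj
    have hjℓ : (j : ℝ) + 1 ≤ ℓ := by exact_mod_cast mem_range.1 hj
    have hpos : 0 < (k : ℝ) - j := by linarith
    refine ⟨?_, sub_lt_self _ (div_pos hr0 hpos)⟩
    rw [sub_nonneg, div_le_one hpos]
    linarith
  obtain ⟨m, rfl⟩ := Nat.exists_eq_add_of_lt hℓ0
  rw [localProd, zero_add, prod_range_succ]
  refine lt_of_le_of_lt (mul_le_of_le_one_left (hf m (by simp)).1 (prod_le_one ?_ ?_))
    (hf m (by simp)).2
  · exact fun j hj => (hf j (by simp at hj ⊢; omega)).1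
  · exact fun j hj => (hf j (by simp at hj ⊢; omega)).2.le

theorem localProd_eq_choose {k ℓ r : ℕ} {α : ℝ} (hr : 1 / α = r) (hℓ : ℓ + r ≤ k) :
    localProd k ℓ α = ((k - ℓ).choose r : ℝ) / (k.choose r : ℝ) := by
  induction ℓ with
  | zero =>
    have : (k.choose r : ℝ) ≠ 0 := by exact_mod_cast (Nat.choose_pos (by omega)).ne'
    simp [localProd, this]
  | succ ℓ ih =>
    rw [localProd, prod_range_succ, ← localProd, ih (by omega), hr]
    obtain ⟨N, hN⟩ : ∃ N, k - ℓ = N + 1 := ⟨k - ℓ - 1, by omega⟩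
    have hN' : (k : ℝ) - ℓ = (N : ℝ) + 1 := by
      rw [← Nat.cast_sub (by omega), hN]; push_cast; rfl
    have h := Nat.choose_mul_succ_eq N r
    have h' : (N.choose r : ℝ) * (N + 1) = (N + 1).choose r * ((N : ℝ) + 1 - r) := by
      have hsub : ((N + 1 - r : ℕ) : ℝ) = (N : ℝ) + 1 - r := by
        rw [Nat.cast_sub (by omega)]; push_cast; rfl
      rw [← hsub]; exact_mod_cast h
    rw [show k - (ℓ + 1) = N by omega, hN, hN', div_mul_eq_mul_div]
    congr 1
    have : (N : ℝ) + 1 ≠ 0 := by positivity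
    field_simp
    linarith

/-- With `r = 1/α`, `m = ⌈r⌉₊` and `x = k + 1 - ℓ - r`, the product is `Γ(k+1-r) Γ(k+1-ℓ) / (Γ(k+1)
Γ(x))`. The Gamma estimate is used twice: shifting `k + 1` by `r` yields `(k+1)^r`, and shifting `x`
by `m - r` reaches `k - ℓ + 1 - m`, whose Gamma value differs from `Γ(k+1-ℓ)` by the finite product
in `kappa`. -/
theorem kappa_le_localProd {k ℓ : ℕ} {α : ℝ} (hα : 0 < α) (hℓ : ℓ + ⌈1 / α⌉₊ ≤ k) :
    kappa k ℓ α ≤ localProd k ℓ α := by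
  set r := 1 / α with hr
  set m := ⌈r⌉₊ with hm
  have hrm : r ≤ m := Nat.le_ceil _
  have hr0 : 0 < r := by positivity
  have hk : (ℓ : ℝ) + m ≤ k := by exact_mod_cast hℓ
  have hℓ0 : (0 : ℝ) ≤ ℓ := Nat.cast_nonneg _
  set x : ℝ := (k : ℝ) + 1 - ℓ - r with hx
  have hxpos : 0 < x := by linarith
  have e1 := Gamma_eq_prod_mul_Gamma (N := (k : ℝ)) (m := ℓ) (by linarith)
  have e2 := Gamma_eq_prod_mul_Gamma (N := (k : ℝ) - r) (m := ℓ) (by linarith)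
  have e3 := Gamma_eq_prod_mul_Gamma (N := (k : ℝ) - ℓ) (m := m) (by linarith)
  have g1 := Gamma_le_Gamma_sub_mul_rpow (x := (k : ℝ) + 1) (s := r) hr0.le (by linarith)
  have g2 := Gamma_le_Gamma_sub_mul_rpow (x := x) (s := m - r) (by linarith) (by linarith)
  rw [show (k : ℝ) + 1 - r = k - r + 1 by ring, e1, e2,
    show (k : ℝ) + 1 - ℓ = k - ℓ + 1 by ring, e3,
    show (k : ℝ) - r + 1 - ℓ = x by rw [hx]; ring] at g1
  rw [show x - (m - r) = (k : ℝ) - ℓ + 1 - m by rw [hx]; ring] at g2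
  have hG3 : 0 < Real.Gamma ((k : ℝ) - ℓ + 1 - m) := Real.Gamma_pos_of_pos (by linarith)
  have hN1 : 0 ≤ ∏ i ∈ range ℓ, ((k : ℝ) - r - i) := prod_nonneg fun i hi => by
    have : (i : ℝ) + 1 ≤ ℓ := by exact_mod_cast mem_range.1 hi
    linarith
  have hN2' : ∀ i ∈ range ℓ, 0 < (k : ℝ) - i := fun i hi => by
    have : (i : ℝ) + 1 ≤ ℓ := by exact_mod_cast mem_range.1 hi
    linarith
  have hN2 : 0 < ∏ i ∈ range ℓ, ((k : ℝ) - i) := prod_pos hN2'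
  have hloc : localProd k ℓ α =
      (∏ i ∈ range ℓ, ((k : ℝ) - r - i)) / ∏ i ∈ range ℓ, ((k : ℝ) - i) := by
    rw [localProd, ← prod_div_distrib]
    refine prod_congr rfl fun i hi => ?_
    have := (hN2' i hi).ne'
    rw [← hr, one_sub_div this, sub_right_comm]
  have hK : 0 < ((k : ℝ) + 1) ^ r := by positivity
  have hX : 0 < x ^ ((m : ℝ) - r) := Real.rpow_pos_of_pos hxpos _
  rw [hloc, kappa, ← hr, ← hm, ← hx, show r - (m : ℝ) = -((m : ℝ) - r) by ring,
    Real.rpow_neg hxpos.le, div_le_div_iff₀ hK hN2, inv_mul_eq_div, div_mul_eq_mul_div,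
    div_le_iff₀ hX]
  refine le_of_mul_le_mul_right ?_ hG3
  have g3 := mul_le_mul_of_nonneg_left g2 (mul_nonneg hN1 hK.le)
  linarith

/-! ### Normalization and contraction under the down operator -/

section

variable {n k : ℕ} {α : ℝ} {μ : KSubset n k → ℝ}

theorem sum_pos_of_ne_zero (hμ : ∀ S, 0 ≤ μ S) (hμ0 : μ ≠ 0) : 0 < ∑ S, μ S := by
  refine (sum_nonneg fun S _ => hμ S).lt_of_ne fun h => hμ0 ?_
  funext S
  exact (sum_eq_zero_iff_of_nonneg fun S _ => hμ S).1 h.symm S (mem_univ S)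

theorem normalize_nonneg (hμ : ∀ S, 0 ≤ μ S) (S : KSubset n k) : 0 ≤ normalize μ S :=
  div_nonneg (hμ S) (sum_nonneg fun S _ => hμ S)

theorem sum_normalize (h : 0 < ∑ S, μ S) : ∑ S, normalize μ S = 1 := by
  simp only [normalize]
  rw [← sum_div, div_self h.ne']

theorem IsFracLogConcave.normalize (h : IsFracLogConcave α μ) (hμ : ∀ S, 0 ≤ μ S)
    (hpos : 0 < ∑ S, μ S) : IsFracLogConcave α (normalize μ) := by
  have he : ∀ z, fracGen α (FLC.normalize μ) z = (∑ S, μ S)⁻¹ * fracGen α μ z := by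
    intro z
    simp only [fracGen_eq, FLC.normalize, mul_sum]
    exact sum_congr rfl fun S _ => by ring
  intro x y hx hy s t hs ht hst
  have hc : 0 < (∑ S, μ S)⁻¹ := inv_pos.2 hpos
  rw [he, he, he, Real.mul_rpow hc.le (fracGen_nonneg hμ hx),
    Real.mul_rpow hc.le (fracGen_nonneg hμ hy)]
  calc _ = ((∑ S, μ S)⁻¹) ^ (s + t) * (fracGen α μ x ^ s * fracGen α μ y ^ t) := by
          rw [Real.rpow_add hc]; ring
    _ ≤ _ := by
      rw [hst, Real.rpow_one]
      exact mul_le_mul_of_nonneg_left (h x y hx hy s t hs ht hst) hc.le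

theorem up_normalize (h : 0 < ∑ S, μ S) (ℓ : ℕ) : up ℓ (normalize μ) = up ℓ μ := by
  ext T S
  simp only [up, Matrix.of_apply, normalize]
  split_ifs with hs
  · have he : ∑ S' : KSubset n k, (if T.1 ⊆ S'.1 then μ S' / ∑ y, μ y else 0) =
        (∑ S' : KSubset n k, if T.1 ⊆ S'.1 then μ S' else 0) / ∑ y, μ y := by
      rw [sum_div]
      refine sum_congr rfl fun S' _ => ?_
      split_ifs <;> simp
    rw [he, div_div_div_cancel_right₀ h.ne']
  · rfl

theorem vecMul_down (w : KSubset n k → ℝ) (ℓ : ℕ) (T : KSubset n ℓ) :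
    (w ᵥ* down n k ℓ) T = upSum w T.1 / (k.choose ℓ : ℝ) := by
  simp only [Matrix.vecMul, dotProduct, down, Matrix.of_apply, upSum, sum_div]
  refine sum_congr rfl fun S _ => ?_
  split_ifs <;> simp [div_eq_mul_inv]

theorem sum_KSubset_eq (ℓ : ℕ) (f : Finset (Fin n) → ℝ) :
    ∑ T : KSubset n ℓ, f T.1 = ∑ T ∈ powersetCard ℓ (univ : Finset (Fin n)), f T :=
  (sum_subtype (powersetCard ℓ (univ : Finset (Fin n)))
    (p := fun S => S.card = ℓ) (by simp [mem_powersetCard]) f).symm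

theorem relEntropy_down {ν : KSubset n k → ℝ} (hν : ∀ S, 0 ≤ ν S) (hμ : ∀ S, 0 ≤ μ S)
    (hνμ : ∀ S, μ S = 0 → ν S = 0) {ℓ : ℕ} (hℓ : ℓ ≤ k) :
    relEntropy (ν ᵥ* down n k ℓ) (μ ᵥ* down n k ℓ) = (levelEntropy ν μ ℓ : EReal) := by
  have hC : (k.choose ℓ : ℝ) ≠ 0 := by exact_mod_cast (Nat.choose_pos hℓ).ne'
  rw [relEntropy, if_pos]
  · rw [levelEntropy, ← sum_KSubset_eq ℓ (fun T => upSum ν T / (k.choose ℓ : ℝ) *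
      Real.log (upSum ν T / upSum μ T))]
    congr 1
    refine sum_congr rfl fun T _ => ?_
    rw [vecMul_down, vecMul_down, div_div_div_cancel_right₀ hC]
  · intro T hT
    rw [vecMul_down, div_eq_zero_iff, or_iff_left hC] at hT
    rw [vecMul_down, upSum_eq_zero_of_dominated hν hμ hνμ hT, zero_div]

/-- Local contraction factors bound the contraction of relative entropy under the down operator. -/
theorem IsFracLogConcave.downContracts (h : IsFracLogConcave α μ) (hα : 0 < α)
    (hμ : ∀ S, 0 ≤ μ S) (hpos : 0 < ∑ S, μ S) {ℓ : ℕ} (hℓ : ℓ + ⌈1 / α⌉₊ ≤ k)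
    {κ : ℝ} (hκ : κ ≤ localProd k ℓ α) : DownContracts ℓ μ κ := by
  rintro ν ⟨hν, hν1⟩
  have hp := normalize_nonneg hμ
  have hp1 := sum_normalize hpos
  by_cases hac : ∀ S, FLC.normalize μ S = 0 → ν S = 0
  · rw [relEntropy_down hν hp hac (by omega), relEntropy, if_pos hac, ← levelEntropy_self,
      ← EReal.coe_mul, EReal.coe_le_coe_iff]
    have key := (h.normalize hμ hpos).localProd_mul_le hα hp hν hac hℓ
    have h0 : levelEntropy ν (FLC.normalize μ) 0 = 0 := by
      rw [levelEntropy_zero, hν1, hp1]; simp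
    have hk := levelEntropy_zero_le hp hν hac
    rw [h0] at key hk
    nlinarith [mul_le_mul_of_nonneg_right hκ hk]
  · rw [show relEntropy ν (FLC.normalize μ) = ⊤ from if_neg hac]
    -- At `ℓ = 0` the value `κ = 1` is allowed and the right side may be `0 * ⊤ = 0`, but the left
    -- side is then `0` too.
    rcases Nat.eq_zero_or_pos ℓ with rfl | hℓ0
    · have hκ1 : 0 ≤ 1 - κ := by simpa [localProd] using hκ
      refine le_trans (le_of_eq ?_) (mul_nonneg (EReal.coe_nonneg.2 hκ1) le_top)
      have hT : ∀ T : KSubset n 0, T.1 = ∅ := fun T => card_eq_zero.1 T.2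
      have hv : ∀ T : KSubset n 0, (ν ᵥ* down n k 0) T = 1 ∧
          (FLC.normalize μ ᵥ* down n k 0) T = 1 := fun T => by
        simp [vecMul_down, hT, upSum_empty, hν1, hp1]
      rw [relEntropy, if_pos fun T hT => absurd hT (by simp [hv T])]
      simp [hv]
    · have hlt := hκ.trans_lt (localProd_lt_one hα hℓ0 hℓ)
      rw [EReal.coe_mul_top_of_pos (sub_pos.2 hlt)]
      exact le_top

/-! ### The modified log-Sobolev inequality -/

section ModifiedLogSobolev

variable {Ω : Type*} [Fintype Ω]

/-- At `x = 0` the real logarithm gives `0`, while the extended product is `0` or `(-c d) * (-∞) =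
⊤`. -/
theorem coe_mul_log_le {c d : ℝ} (x : ℝ≥0) (hc : 0 ≤ c) (hd : 0 ≤ d) :
    ((c * (x - d) * Real.log x : ℝ) : EReal) ≤
      ((c * (x - d) : ℝ) : EReal) * ENNReal.log (x : ℝ≥0∞) := by
  rcases eq_or_ne x 0 with rfl | hx
  · simp only [NNReal.coe_zero, Real.log_zero, mul_zero, zero_sub, ENNReal.coe_zero,
      ENNReal.log_zero, EReal.coe_zero]
    rcases (mul_nonneg hc hd).eq_or_lt with h | h
    · rw [mul_neg, ← h]; simp
    · rw [EReal.coe_mul_bot_of_neg (by linarith)]; exact le_top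
  · rw [ENNReal.log_of_nnreal hx, ← EReal.coe_mul]

theorem sum_le_dirichletForm {μ : Ω → ℝ} {P : Matrix Ω Ω ℝ} (f : Ω → ℝ≥0) (hμ : ∀ x, 0 ≤ μ x)
    (hP : ∀ x, 0 ≤ (P *ᵥ fun y => (f y : ℝ)) x) (s : Finset Ω) :
    ((∑ x ∈ s, μ x * (f x - (P *ᵥ fun y => (f y : ℝ)) x) * Real.log (f x) : ℝ) : EReal) ≤
      ∑ x ∈ s, ((μ x * (f x - (P *ᵥ fun y => (f y : ℝ)) x) : ℝ) : EReal) *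
        ENNReal.log (f x : ℝ≥0∞) := by
  classical
  induction s using Finset.induction_on with
  | empty => simp
  | insert x s hx ih =>
    rw [sum_insert hx, sum_insert hx, EReal.coe_add]
    exact add_le_add (coe_mul_log_le (f x) (hμ x) (hP x)) ih

/-- The summand at `x` is a negative number times `-∞`, and the remaining summands have a real lower
bound. -/
theorem dirichletForm_eq_top {μ : Ω → ℝ} {P : Matrix Ω Ω ℝ} (f : Ω → ℝ≥0) (hμ : ∀ x, 0 ≤ μ x)
    (hP : ∀ x, 0 ≤ (P *ᵥ fun y => (f y : ℝ)) x) {x : Ω} (hx : μ x ≠ 0) (hfx : f x = 0)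
    (hPx : (P *ᵥ fun y => (f y : ℝ)) x ≠ 0) :
    dirichletForm μ P (fun x => (f x : ℝ)) (fun x => ENNReal.log (f x : ℝ≥0∞)) = ⊤ := by
  classical
  rw [dirichletForm, ← add_sum_erase univ _ (mem_univ x)]
  have hneg : μ x * ((f x : ℝ) - (P *ᵥ fun y => (f y : ℝ)) x) < 0 := by
    rw [hfx, NNReal.coe_zero, zero_sub, mul_neg, neg_lt_zero]
    exact mul_pos ((hμ x).lt_of_ne hx.symm) ((hP x).lt_of_ne hPx.symm)
  rw [show ENNReal.log (f x : ℝ≥0∞) = ⊥ by simp [hfx], EReal.coe_mul_bot_of_neg hneg]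
  refine EReal.top_add_of_ne_bot ?_
  exact ((EReal.bot_lt_coe _).trans_le (sum_le_dirichletForm f hμ hP (univ.erase x))).ne'

end ModifiedLogSobolev

theorem up_mulVec (ℓ : ℕ) (f : KSubset n k → ℝ) (T : KSubset n ℓ) :
    (up ℓ μ *ᵥ f) T = upSum (fun S => μ S * f S) T.1 / upSum μ T.1 := by
  simp only [Matrix.mulVec, dotProduct, up, Matrix.of_apply]
  rw [upSum, sum_div]
  refine sum_congr rfl fun S _ => ?_
  split_ifs
  · rw [upSum]; ring
  · simp

theorem downUp_mulVec (ℓ : ℕ) (f : KSubset n k → ℝ) (S : KSubset n k) :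
    (downUp ℓ μ *ᵥ f) S = ∑ T ∈ powersetCard ℓ (univ : Finset (Fin n)),
      if T ⊆ S.1 then upSum (fun S => μ S * f S) T / upSum μ T / (k.choose ℓ : ℝ) else 0 := by
  rw [← sum_KSubset_eq ℓ (fun T => if T ⊆ S.1 then
    upSum (fun S => μ S * f S) T / upSum μ T / (k.choose ℓ : ℝ) else 0), downUp,
    ← Matrix.mulVec_mulVec]
  rw [Matrix.mulVec, dotProduct]
  refine sum_congr rfl fun T _ => ?_
  rw [up_mulVec, down, Matrix.of_apply]
  split_ifs <;> ring

/-- The entropy production of the down-up walk dominates the entropy lost in the down step. -/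
theorem levelEntropy_sub_le_sum {f : KSubset n k → ℝ} (hμ : ∀ S, 0 ≤ μ S) (hf : ∀ S, 0 ≤ f S)
    {ℓ : ℕ} (hℓ : ℓ ≤ k)
    (hnd : ∀ S, μ S ≠ 0 → f S = 0 → (downUp ℓ μ *ᵥ f) S = 0) :
    levelEntropy (fun S => μ S * f S) μ k - levelEntropy (fun S => μ S * f S) μ ℓ ≤
      ∑ S, μ S * (f S - (downUp ℓ μ *ᵥ f) S) * Real.log (f S) := by
  set ν : KSubset n k → ℝ := fun S => μ S * f S with hνdef
  have hν : ∀ S, 0 ≤ ν S := fun S => mul_nonneg (hμ S) (hf S)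
  have hνμ : ∀ S, μ S = 0 → ν S = 0 := fun S h => by simp [hνdef, h]
  have hC : (0 : ℝ) < k.choose ℓ := by exact_mod_cast Nat.choose_pos hℓ
  have hk : levelEntropy ν μ k = ∑ S, μ S * f S * Real.log (f S) := by
    rw [levelEntropy_self]
    refine sum_congr rfl fun S _ => ?_
    by_cases h : μ S = 0
    · simp [hνdef, h]
    · simp only [hνdef, mul_div_cancel_left₀ _ h]
  have hswap : ∑ S, μ S * (downUp ℓ μ *ᵥ f) S * Real.log (f S) =
      ∑ T ∈ powersetCard ℓ (univ : Finset (Fin n)), upSum ν T / upSum μ T / (k.choose ℓ : ℝ) *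
        upSum (fun S => μ S * Real.log (f S)) T := by
    simp only [downUp_mulVec, mul_sum, sum_mul]
    rw [sum_comm]
    refine sum_congr rfl fun T _ => ?_
    rw [upSum, upSum, upSum, mul_sum]
    refine sum_congr rfl fun S _ => ?_
    split_ifs
    · ring
    · simp
  have hle : ∑ S, μ S * (downUp ℓ μ *ᵥ f) S * Real.log (f S) ≤ levelEntropy ν μ ℓ := by
    rw [hswap, levelEntropy]
    refine sum_le_sum fun T hT => ?_
    rcases (upSum_nonneg hν T).eq_or_lt with h0 | hN
    · simp [← h0]
    have hM : 0 < upSum μ T := (upSum_nonneg hμ T).lt_of_ne fun h' =>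
      hN.ne' (upSum_eq_zero_of_dominated hν hμ hνμ h'.symm)
    set g := upSum ν T / upSum μ T with hg
    have hgpos : 0 < g := div_pos hN hM
    -- If `f` vanished at such an `S`, the walk from `S` through `T` would make `P f` positive
    -- there, contrary to `hnd`.
    have hfpos : ∀ S : KSubset n k, T ⊆ S.1 → μ S ≠ 0 → 0 < f S := by
      intro S hS hμS
      refine (hf S).lt_of_ne fun h' => ?_
      have h1 := hnd S hμS h'.symm
      rw [downUp_mulVec, sum_eq_zero_iff_of_nonneg] at h1
      · have h2 := h1 T hT
        rw [if_pos hS] at h2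
        exact (div_pos hgpos hC).ne' h2
      · intro T' _
        split_ifs
        · exact div_nonneg (div_nonneg (upSum_nonneg hν T') (upSum_nonneg hμ T')) hC.le
        · rfl
    -- Jensen for `log` under `μ` conditioned on containing `T`, where `g` is the conditional mean
    -- of `f`.
    have hjen : upSum (fun S => μ S * Real.log (f S)) T ≤ upSum μ T * Real.log g := by
      have h1 : upSum (fun S => μ S * Real.log (f S)) T ≤
          upSum μ T * Real.log g + (upSum ν T / g - upSum μ T) := by
        rw [upSum, upSum, upSum, sum_mul, sum_div, ← sum_sub_distrib, ← sum_add_distrib]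
        refine sum_le_sum fun S _ => ?_
        split_ifs with hS
        · by_cases hμS : μ S = 0
          · simp [hνdef, hμS]
          · have hfS := hfpos S hS hμS
            have h2 := Real.log_le_sub_one_of_pos (div_pos hfS hgpos)
            rw [Real.log_div hfS.ne' hgpos.ne'] at h2
            have h3 := mul_le_mul_of_nonneg_left h2 (hμ S)
            have h4 : ν S / g = μ S * (f S / g) := mul_div_assoc _ _ _
            rw [h4]
            linarith
        · simp
      have h2 : upSum ν T / g = upSum μ T := by rw [hg]; field_simp
      rw [h2] at h1
      linarith
    calc _ ≤ g / (k.choose ℓ : ℝ) * (upSum μ T * Real.log g) :=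
          mul_le_mul_of_nonneg_left hjen (by positivity)
      _ = _ := by rw [hg]; field_simp
  have : ∑ S, μ S * (f S - (downUp ℓ μ *ᵥ f) S) * Real.log (f S) =
      levelEntropy ν μ k - ∑ S, μ S * (downUp ℓ μ *ᵥ f) S * Real.log (f S) := by
    rw [hk, ← sum_sub_distrib]
    exact sum_congr rfl fun S _ => by ring
  rw [this]
  linarith

theorem IsFracLogConcave.le_modifiedLogSobolev (h : IsFracLogConcave α μ) (hα : 0 < α)
    (hμ : ∀ S, 0 ≤ μ S) (hμ1 : ∑ S, μ S = 1) {ℓ : ℕ} (hℓ : ℓ + ⌈1 / α⌉₊ ≤ k)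
    {κ : ℝ} (hκ : κ ≤ localProd k ℓ α) :
    ((1 / 2 * κ : ℝ) : EReal) ≤ modifiedLogSobolev μ (downUp ℓ μ) := by
  refine le_sInf ?_
  rintro _ ⟨f, hent, rfl⟩
  set ν : KSubset n k → ℝ := fun S => μ S * (f S : ℝ) with hνdef
  have hν : ∀ S, 0 ≤ ν S := fun S => mul_nonneg (hμ S) (f S).2
  have hνμ : ∀ S, μ S = 0 → ν S = 0 := fun S h => by simp [hνdef, h]
  have hent_eq : ent μ f = levelEntropy ν μ k - levelEntropy ν μ 0 := by
    rw [ent, levelEntropy_self, levelEntropy_zero, hμ1, div_one]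
    congr 1
    refine sum_congr rfl fun S _ => ?_
    by_cases h : μ S = 0
    · simp [hνdef, h]
    · simp only [hνdef, mul_div_cancel_left₀ _ h, mul_assoc]
  have hent0 : 0 < ent μ f :=
    (by rw [hent_eq]; exact sub_nonneg.2 (levelEntropy_zero_le hμ hν hνμ) :
      0 ≤ ent μ f).lt_of_ne hent.symm
  rw [EReal.le_div_iff_mul_le (by exact_mod_cast (by linarith : (0 : ℝ) < 2 * ent μ f))
    (EReal.coe_ne_top _), ← EReal.coe_mul]
  have hP : ∀ S, 0 ≤ (downUp ℓ μ *ᵥ fun S => (f S : ℝ)) S := by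
    intro S
    rw [downUp_mulVec]
    refine sum_nonneg fun T _ => ?_
    split_ifs
    · exact div_nonneg (div_nonneg (upSum_nonneg hν T) (upSum_nonneg hμ T)) (Nat.cast_nonneg _)
    · rfl
  -- If `f` vanishes at a state of positive mass where `P f` does not, the Dirichlet form is `⊤`;
  -- otherwise the real-valued entropy bound applies.
  by_cases hnd : ∀ S, μ S ≠ 0 → (f S : ℝ) = 0 → (downUp ℓ μ *ᵥ fun S => (f S : ℝ)) S = 0
  · refine le_trans ?_ (sum_le_dirichletForm f hμ hP univ)
    rw [EReal.coe_le_coe_iff]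
    have h1 := levelEntropy_sub_le_sum hμ (fun S => (f S).2) (by omega) hnd
    have h2 := h.localProd_mul_le hα hμ hν hνμ hℓ
    have h3 := mul_le_mul_of_nonneg_right hκ hent0.le
    rw [← hent_eq] at h2
    refine le_trans ?_ (h3.trans (h2.trans h1))
    linarith
  · push Not at hnd
    obtain ⟨S, h1, h2, h3⟩ := hnd
    rw [dirichletForm_eq_top f hμ hP h1 (NNReal.coe_eq_zero.1 h2) h3]
    exact le_top

end

end FLC

theorem mainTheorem2 :
    ∃ c : ℝ, 0 < c ∧
      ∀ (n k ℓ : ℕ) (α : ℝ) (μ : KSubset n k → ℝ),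
        0 < α → α ≤ 1 →
        (∀ S, 0 ≤ μ S) → μ ≠ 0 →
        FLC.IsFracLogConcave α μ →
        ℓ + ⌈1 / α⌉₊ ≤ k →
        (FLC.DownContracts ℓ μ (FLC.kappa k ℓ α) ∧
          ((c * FLC.kappa k ℓ α : ℝ) : EReal) ≤
            FLC.modifiedLogSobolev (FLC.normalize μ) (FLC.downUp ℓ μ)) ∧
        (∀ r : ℕ, 1 / α = (r : ℝ) →
          FLC.DownContracts ℓ μ (((k - ℓ).choose r : ℝ) / (k.choose r : ℝ)) ∧
          ((c * (((k - ℓ).choose r : ℝ) / (k.choose r : ℝ)) : ℝ) : EReal) ≤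
            FLC.modifiedLogSobolev (FLC.normalize μ) (FLC.downUp ℓ μ)) := by
  -- The constant `1 / 2` cancels the `2` in the denominator of `modifiedLogSobolev`.
  refine ⟨1 / 2, by norm_num, fun n k ℓ α μ hα _ hμ hμ0 h hℓ => ?_⟩
  have hpos := FLC.sum_pos_of_ne_zero hμ hμ0
  have key : ∀ κ, κ ≤ FLC.localProd k ℓ α → FLC.DownContracts ℓ μ κ ∧
      ((1 / 2 * κ : ℝ) : EReal) ≤
        FLC.modifiedLogSobolev (FLC.normalize μ) (FLC.downUp ℓ μ) := fun κ hκ => by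
    refine ⟨h.downContracts hα hμ hpos hℓ hκ, ?_⟩
    rw [FLC.downUp, ← FLC.up_normalize hpos, ← FLC.downUp]
    exact (h.normalize hμ hpos).le_modifiedLogSobolev hα (FLC.normalize_nonneg hμ)
      (FLC.sum_normalize hpos) hℓ hκ
  refine ⟨key _ (FLC.kappa_le_localProd hα hℓ), fun r hr => key _ ?_⟩
  rw [hr, Nat.ceil_natCast] at hℓ
  exact (FLC.localProd_eq_choose hr hℓ).ge
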